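/- Let $K$ be an imaginary quadratic field with ring of integers $\mathcal{O}_K$, let $f>0$ be an integer, and let $\mathcal{O}_f=\mathbf{Z}+f\mathcal{O}_K$ be the order of conductor $f$ in $\mathcal{O}_K$. Let $K_f$ be the ring class field of $\mathcal{O}_f$, i.e. the finite abelian extension of $K$, unramified at all primes of $K$ not dividing $f$, such that the kernel of the Artin map $I_K(f)\to\mathrm{Gal}(K_f/K)$ is the subgroup generated by the principal ideals $\alpha\mathcal{O}_K$ with $0\neq\alpha\in\mathcal{O}_f$ prime to $f$; here $I_K(f)$ is the group of fractional ideals of $K$ prime to $f$. Then \begin{enumerate} \item if $K=\mathbf{Q}(\sqrt{-7})$, then $f\leq\max\{[K_f:K]^2,2\}$; \item if $K=\mathbf{Q}(i)$, then $f\leq\max\{[K_f:K]^2,5\}$; \item if $K=\mathbf{Q}(\zeta_3)$, where $\zeta_3$ is a primitive cube root of unity, then $f\leq\max\{[K_f:K]^2,7\}$; \item in all other cases, $f\leq[K_f:K]^2$. \end{enumerate} In all cases, $f\leq 3\,[K_f:K]^2$. -/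

import Mathlib

open scoped NumberField nonZeroDivisors

/-- The order `𝓞_f = ℤ + f 𝓞_K` of conductor `f` in the ring of integers of `K`. -/
def orderOfConductor (K : Type*) [Field K] (f : ℕ) : Subring (𝓞 K) where
  carrier := {x | ∃ (a : ℤ) (b : 𝓞 K), x = (a : 𝓞 K) + (f : 𝓞 K) * b}
  mul_mem' := by
    rintro _ _ ⟨a, b, rfl⟩ ⟨c, d, rfl⟩
    exact ⟨a * c, a * d + b * c + f * b * d, by push_cast; ring⟩
  one_mem' := ⟨1, 0, by simp⟩
  add_mem' := by
    rintro _ _ ⟨a, b, rfl⟩ ⟨c, d, rfl⟩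
    exact ⟨a + c, b + d, by push_cast; ring⟩
  zero_mem' := ⟨0, 0, by simp⟩
  neg_mem' := by
    rintro _ ⟨a, b, rfl⟩
    exact ⟨-a, -b, by push_cast; ring⟩

/-- An ideal of `𝓞 K` is prime to `f` if it is comaximal with `f 𝓞_K`. -/
def IsPrimeToConductor {K : Type*} [Field K] (f : ℕ) (I : Ideal (𝓞 K)) : Prop :=
  IsCoprime I (Ideal.span {(f : 𝓞 K)})

/-- The group `I_K(f)` of fractional ideals of `K` generated by the nonzero integral ideals
prime to `f`. (Units of the monoid of fractional ideals are the nonzero fractional ideals.) -/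
def idealsPrimeTo (K : Type*) [Field K] (f : ℕ) :
    Subgroup (FractionalIdeal (𝓞 K)⁰ K)ˣ :=
  Subgroup.closure {u | ∃ I : Ideal (𝓞 K), IsPrimeToConductor f I ∧
    (u : FractionalIdeal (𝓞 K)⁰ K) = (I : FractionalIdeal (𝓞 K)⁰ K)}

/-- The group `P_{K,ℤ}(f)` generated by the principal ideals `α 𝓞_K` with
`α ∈ ℤ + f 𝓞_K` nonzero and prime to `f`. (For `α = a + f β` with `a ∈ ℤ`, being prime to `f`
means `gcd(a, f) = 1`.) -/
def ringClassSubgroup (K : Type*) [Field K] (f : ℕ) :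
    Subgroup (FractionalIdeal (𝓞 K)⁰ K)ˣ :=
  Subgroup.closure {u | ∃ α : 𝓞 K, α ∈ orderOfConductor K f ∧ α ≠ 0 ∧
    IsPrimeToConductor f (Ideal.span {α}) ∧
    (u : FractionalIdeal (𝓞 K)⁰ K) = (Ideal.span {α} : Ideal (𝓞 K))}

/-- `φ : I_K(f) → Gal(L/K)` is the Artin map of `L/K`: it sends each nonzero prime `𝔭 ∤ f` to its
Artin symbol, i.e. `φ(𝔭) x ≡ x ^ #(𝓞_K/𝔭) mod 𝔮` for all `x ∈ 𝓞_L` and all primes `𝔮 ∣ 𝔭`.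
Since `I_K(f)` is generated by these primes and the Frobenius is unique at
unramified primes, there is at most one such `φ` when `L/K` is unramified outside `f`. -/
def IsArtinMap (K L : Type*) [Field K] [Field L] [Algebra K L] (f : ℕ)
    (φ : idealsPrimeTo K f →* Gal(L/K)) : Prop :=
  ∀ (u : idealsPrimeTo K f) (P : Ideal (𝓞 K)), P.IsPrime →
    ((u : (FractionalIdeal (𝓞 K)⁰ K)ˣ) : FractionalIdeal (𝓞 K)⁰ K) = P →
    ∀ Q : Ideal (𝓞 L), Q.IsPrime → Q.LiesOver P →
      ∀ x : 𝓞 L, φ u • x - x ^ Nat.card (𝓞 K ⧸ P) ∈ Q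

/-- `L` is the ring class field of the order `ℤ + f 𝓞_K` of the totally complex field `K`:
the finite abelian extension of `K`, unramified at the primes not dividing `f`, for which the
kernel of the Artin map `I_K(f) → Gal(L/K)` is exactly `P_{K,ℤ}(f)`. -/
structure IsRingClassField (K L : Type*) [Field K] [Field L] [Algebra K L] (f : ℕ) : Prop where
  finite : FiniteDimensional K L
  abelian : IsAbelianGalois K L
  unramified : ∀ (P : Ideal (𝓞 K)), P.IsPrime → P ≠ ⊥ → IsPrimeToConductor f P →
    ∀ (Q : Ideal (𝓞 L)) [Q.IsPrime], Q.LiesOver P → Algebra.IsUnramifiedAt (𝓞 K) Q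
  ker_artinMap : ∃ φ : idealsPrimeTo K f →* Gal(L/K), IsArtinMap K L f φ ∧
    φ.ker = (ringClassSubgroup K f).subgroupOf (idealsPrimeTo K f)

/-!
The kernel of the Artin map `I_K(f) → Gal(K_f/K)` is `P_{K,ℤ}(f)`, so the degree `n = [K_f : K]` is
at least the number of classes of `I_K(f)/P_{K,ℤ}(f)`. These classes are bounded from below by
counting ideals `α J`, with `α` running through `(𝓞_K/f)ˣ` and `J` through ideals prime to `f` in
distinct ideal classes: two of them with the same `J` agree modulo `P_{K,ℤ}(f)` only if the residues
differ by an element of the image of `𝓞_Kˣ × (ℤ/f)ˣ`, whose order is at most `w φ(f) / 2`, where `w`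
is the number of roots of unity in `K` (`two_mul_card_units_quotient_le`).

Put `ψ(f) = #(𝓞_K/f)ˣ / φ(f)` and `q(f) = ψ(f) ^ 2 / f` (`unitRatio`). With a single `J`, the count
says `q(f) f ≤ (w/2) ^ 2 n ^ 2` (`IsRingClassField.unitRatio_mul_le`). The function `q` is
multiplicative, `q(p ^ (k + 1)) = q(p) p ^ k`, and `q(p)` is `(p + 1) ^ 2 / p`, `p` or
`(p - 1) ^ 2 / p` according as `p` is inert, ramified or split. So `q(f) ≥ (w/2) ^ 2` off a small set
of conductors `f`:

* for `ℚ(i)`, where `w = 4`, one has `q ≥ 2` at all prime powers and `q ≥ 4` except possibly at `2`,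
  `3`, `5`;
* for `ℚ(ζ₃)`, where `w = 6`, one has `q ≥ 3` at all prime powers and `q ≥ 9` except possibly
  at `2`, `3`, `5`, `7`;
* otherwise `w = 2`, and only a split prime `2`, with `q(2) = 1/2`, can make `q(f) < 1`. In
  `ℚ(√-7)` this is compensated by every odd prime, since `3` does not split there, so `f = 2` is the
  only exception. In any other field a prime above a split `2` is not principal, for a generator
  would be a root of `X ^ 2 ± X + 2`
  (`exists_sq_eq_neg_seven_of_isPrincipal`); a nonprincipal `J` then doubles the count
  (`IsRingClassField.four_mul_unitRatio_mul_le`).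

The uniform bound `f ≤ 3 n ^ 2` follows from the weaker estimates for `q` in the exceptional cases.
-/

/-! ### Units of residue rings -/

/-- A surjective local homomorphism of finite rings has the same fibre size on units as on all
elements: the kernel on units is `1 + ker π`. -/
theorem card_units_mul_card_of_surjective {A B : Type*} [CommRing A] [CommRing B] [Finite A]
    (π : A →+* B) (hπ : Function.Surjective π) [IsLocalHom π] :
    Nat.card Aˣ * Nat.card B = Nat.card Bˣ * Nat.card A := by
  have h1 := Subgroup.card_mul_index (Units.map (π : A →* B)).ker
  have h2 := AddSubgroup.card_mul_index (π : A →+ B).ker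
  have hs : Function.Surjective (Units.map (π : A →* B)) := by
    intro u
    obtain ⟨a, ha⟩ := hπ u
    have hu : IsUnit a := IsUnit.of_map π a (ha ▸ u.isUnit)
    exact ⟨hu.unit, Units.ext (by simpa using ha)⟩
  rw [Subgroup.index_ker, MonoidHom.range_eq_top.mpr hs] at h1
  rw [AddSubgroup.index_ker, AddMonoidHom.range_eq_top.mpr hπ] at h2
  rw [Nat.card_congr Subgroup.topEquiv.toEquiv] at h1
  rw [Nat.card_congr AddSubgroup.topEquiv.toEquiv] at h2
  have e : Nat.card (Units.map (π : A →* B)).ker = Nat.card (π : A →+ B).ker := by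
    refine Nat.card_congr (Equiv.ofBijective
      (fun u => ⟨((u : Aˣ) : A) - 1, ?_⟩) ⟨fun u v huv => ?_, fun a => ?_⟩)
    · have := congrArg Units.val (MonoidHom.mem_ker.mp u.2)
      change π _ = 1 at this
      rw [AddMonoidHom.mem_ker, AddMonoidHom.coe_coe, map_sub, this, map_one, sub_self]
    · exact Subtype.ext (Units.ext (sub_left_injective (congrArg Subtype.val huv)))
    · have ha : π a = 0 := a.2
      have hu : IsUnit (1 + (a : A)) := IsUnit.of_map π _ (by simp [ha])
      refine ⟨⟨hu.unit, ?_⟩, ?_⟩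
      · rw [MonoidHom.mem_ker]; ext; simp [ha]
      · ext; simp
  rw [← h1, ← h2, e]; ring

section Quotients
variable {S : Type*} [CommRing S]

theorem card_units_quotient_mul {I J : Ideal S} (h : IsCoprime I J) :
    Nat.card (S ⧸ I * J)ˣ = Nat.card (S ⧸ I)ˣ * Nat.card (S ⧸ J)ˣ := by
  rw [Nat.card_congr ((Units.mapEquiv
    (Ideal.quotientMulEquivQuotientProd I J h).toMulEquiv).trans MulEquiv.prodUnits).toEquiv,
    Nat.card_prod]

variable [IsDedekindDomain S] [Module.Free ℤ S]

theorem card_quotient_eq_absNorm (I : Ideal S) : Nat.card (S ⧸ I) = Ideal.absNorm I := by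
  rw [Ideal.absNorm_apply, Submodule.cardQuot_apply]

variable [Module.Finite ℤ S]

theorem finite_quotient_of_ne_bot {I : Ideal S} (hI : I ≠ ⊥) : Finite (S ⧸ I) := by
  rw [← Ideal.absNorm_ne_zero_iff]
  exact fun h => hI (Ideal.absNorm_eq_zero_iff.mp h)

theorem card_units_quotient_pow {I : Ideal S} (hI : I ≠ ⊥) (k : ℕ) :
    Nat.card (S ⧸ I ^ (k + 1))ˣ = Nat.card (S ⧸ I)ˣ * Ideal.absNorm I ^ k := by
  have hI' : I ^ (k + 1) ≠ ⊥ := pow_ne_zero _ hI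
  have := finite_quotient_of_ne_bot hI'
  have := finite_quotient_of_ne_bot hI
  let π := Ideal.Quotient.factor (Ideal.pow_le_self (I := I) (Nat.succ_ne_zero k))
  have hloc : IsLocalHom π := ⟨fun a ha => by
    obtain ⟨a, rfl⟩ := Ideal.Quotient.mk_surjective a
    exact (Ideal.Quotient.isUnit_mk_pow_iff_isUnit_mk I (Nat.succ_ne_zero k)).mpr ha⟩
  have h := card_units_mul_card_of_surjective π
    (Ideal.Quotient.factor_surjective _)
  rw [card_quotient_eq_absNorm, card_quotient_eq_absNorm, map_pow,
    pow_succ (Ideal.absNorm I), ← mul_assoc] at h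
  have h0 : 0 < Ideal.absNorm I := by
    rw [← card_quotient_eq_absNorm]; exact Nat.card_pos
  exact Nat.eq_of_mul_eq_mul_right h0 h

theorem card_units_quotient_of_isMaximal (I : Ideal S) (hI : I ≠ ⊥) [hm : I.IsMaximal] :
    Nat.card (S ⧸ I)ˣ = Ideal.absNorm I - 1 := by
  have := finite_quotient_of_ne_bot hI
  let := Ideal.Quotient.field I
  rw [← card_quotient_eq_absNorm, Nat.card_units]

/-- The number of units modulo a prime `p`, according as `p` is inert, ramified or split. -/
theorem card_units_quotient_prime (hS : Module.finrank ℤ S = 2) {p : ℕ} (hp : p.Prime) :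
    Nat.card (S ⧸ Ideal.span {(p : S)})ˣ = p ^ 2 - 1 ∨
    (∃ P : Ideal S, P.IsMaximal ∧ Ideal.absNorm P = p ∧ Ideal.span {(p : S)} = P ^ 2 ∧
      Nat.card (S ⧸ Ideal.span {(p : S)})ˣ = (p - 1) * p) ∨
    ∃ P Q : Ideal S, P.IsMaximal ∧ Q.IsMaximal ∧ P ≠ Q ∧ Ideal.absNorm P = p ∧
      Ideal.absNorm Q = p ∧ Ideal.span {(p : S)} = P * Q ∧
      Nat.card (S ⧸ Ideal.span {(p : S)})ˣ = (p - 1) ^ 2 := by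
  have hN : Ideal.absNorm (Ideal.span {(p : S)}) = p ^ 2 := by
    rw [Ideal.absNorm_span_natCast, hS]
  have hp0 : Ideal.span {(p : S)} ≠ ⊥ := by
    intro h
    rw [h, Ideal.absNorm_bot] at hN
    exact (pow_ne_zero 2 hp.ne_zero) hN.symm
  have htop : Ideal.span {(p : S)} ≠ ⊤ := by
    intro h
    rw [h, Ideal.absNorm_top] at hN
    exact hp.one_lt.ne' (by nlinarith [hp.one_lt])
  have prime_of_norm (P : Ideal S) (hP : Ideal.absNorm P = p) : P ≠ ⊥ ∧ P.IsMaximal := by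
    have h0 : P ≠ ⊥ := by
      rintro rfl
      rw [Ideal.absNorm_bot] at hP
      exact hp.ne_zero hP.symm
    have : P.IsPrime := Ideal.isPrime_of_irreducible_absNorm (by rw [hP]; exact hp)
    exact ⟨h0, this.isMaximal h0⟩
  obtain ⟨P, hPm, hle⟩ := Ideal.exists_le_maximal _ htop
  obtain ⟨Q, hQ⟩ := Ideal.dvd_iff_le.mpr hle
  have hPQ : Ideal.absNorm P * Ideal.absNorm Q = p ^ 2 := by rw [← map_mul, ← hQ, hN]
  have hP1 : Ideal.absNorm P ≠ 1 := fun h => hPm.ne_top (Ideal.absNorm_eq_one_iff.mp h)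
  obtain ⟨i, hi, hPi⟩ := (Nat.dvd_prime_pow hp).mp (Dvd.intro _ hPQ)
  interval_cases i
  · simp at hPi; exact absurd (Ideal.absNorm_eq_one_iff.mpr hPi) hP1
  · rw [pow_one] at hPi
    have hQp : Ideal.absNorm Q = p := by
      rw [hPi, sq] at hPQ
      exact Nat.eq_of_mul_eq_mul_left hp.pos hPQ
    obtain ⟨hP0, -⟩ := prime_of_norm P hPi
    obtain ⟨hQ0, hQm⟩ := prime_of_norm Q hQp
    by_cases hne : P = Q
    · subst hne
      rw [← sq] at hQ
      refine Or.inr (Or.inl ⟨P, hPm, hPi, hQ, ?_⟩)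
      rw [hQ, card_units_quotient_pow hP0 1, card_units_quotient_of_isMaximal P hP0, hPi, pow_one]
    · refine Or.inr (Or.inr ⟨P, Q, hPm, hQm, hne, hPi, hQp, hQ, ?_⟩)
      have hco : IsCoprime P Q := Ideal.isCoprime_of_isMaximal hne
      rw [hQ, card_units_quotient_mul hco, card_units_quotient_of_isMaximal P hP0,
        card_units_quotient_of_isMaximal Q hQ0, hPi, hQp, sq]
  · left
    have hQ1 : Q = ⊤ := by
      rw [hPi] at hPQ
      have : 0 < p ^ 2 := pow_pos hp.pos 2
      exact Ideal.absNorm_eq_one_iff.mp (Nat.eq_of_mul_eq_mul_left this (by simpa using hPQ))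
    rw [hQ1, Ideal.mul_top] at hQ
    have : (Ideal.span {(p : S)}).IsMaximal := hQ ▸ hPm
    rw [card_units_quotient_of_isMaximal _ hp0, hN]

/-- A prime of prime norm `p` has residue field `ZMod p`. -/
theorem nonempty_ringHom_zmod_of_absNorm_eq {P : Ideal S} {p : ℕ} (hp : p.Prime)
    (hP : Ideal.absNorm P = p) : Nonempty (S →+* ZMod p) := by
  have := Fact.mk hp
  have h0 : P ≠ ⊥ := by
    rintro rfl
    rw [Ideal.absNorm_bot] at hP
    exact hp.ne_zero hP.symm
  have := finite_quotient_of_ne_bot h0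
  have := Fintype.ofFinite (S ⧸ P)
  have hc : Fintype.card (S ⧸ P) = p := by
    rw [← Nat.card_eq_fintype_card, card_quotient_eq_absNorm, hP]
  exact ⟨((ZMod.ringEquivOfPrime (S ⧸ P) hp hc).symm : S ⧸ P →+* ZMod p).comp
    (Ideal.Quotient.mk P)⟩

end Quotients

/-! ### Units of an imaginary quadratic field -/

section Units
open NumberField NumberField.Units
variable (K : Type*) [Field K] [NumberField K]

/-- The unit rank of an imaginary quadratic field is zero. -/
theorem torsion_eq_top_of_imaginaryQuadratic [IsTotallyComplex K]
    (hK : Module.finrank ℚ K = 2) : torsion K = ⊤ := by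
  have h1 := IsTotallyComplex.finrank K
  have h2 := InfinitePlace.card_eq_nrRealPlaces_add_nrComplexPlaces K
  rw [IsTotallyComplex.nrRealPlaces_eq_zero K] at h2
  have h3 : rank K = 0 := by unfold rank; omega
  refine eq_top_iff.mpr fun x _ => ?_
  obtain ⟨⟨ζ, e⟩, h, -⟩ := exist_unique_eq_mul_prod K x
  have : IsEmpty (Fin (rank K)) := by rw [h3]; infer_instance
  simp only [Finset.univ_eq_empty, Finset.prod_empty, mul_one] at h
  exact h ▸ ζ.2

theorem finite_units_of_imaginaryQuadratic [IsTotallyComplex K]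
    (hK : Module.finrank ℚ K = 2) : Finite (𝓞 K)ˣ := by
  have h : Finite (torsion K) := inferInstance
  rw [torsion_eq_top_of_imaginaryQuadratic K hK] at h
  exact Finite.of_equiv _ Subgroup.topEquiv.toEquiv

theorem card_units_eq_torsionOrder [IsTotallyComplex K]
    (hK : Module.finrank ℚ K = 2) : Nat.card (𝓞 K)ˣ = torsionOrder K := by
  rw [torsionOrder, torsion_eq_top_of_imaginaryQuadratic K hK,
    Nat.card_congr Subgroup.topEquiv.toEquiv]

/-- A rational integer that is a unit of `𝓞_K` has norm `1`, so coprimality of integers descends from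
`𝓞_K` to `ℤ`. -/
theorem isCoprime_of_isCoprime_ringOfIntegers {a b : ℤ}
    (h : IsCoprime (a : 𝓞 K) (b : 𝓞 K)) : IsCoprime a b := by
  rw [Int.isCoprime_iff_gcd_eq_one]
  have hd (c : ℤ) (hc : (Int.gcd a b : ℤ) ∣ c) : ((Int.gcd a b : ℕ) : 𝓞 K) ∣ (c : 𝓞 K) := by
    simpa using map_dvd (Int.castRingHom (𝓞 K)) hc
  have hu : IsUnit ((Int.gcd a b : ℕ) : 𝓞 K) :=
    h.isUnit_of_dvd' (hd a (Int.gcd_dvd_left ..)) (hd b (Int.gcd_dvd_right ..))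
  have hn := Ideal.absNorm_span_natCast (S := 𝓞 K) (Int.gcd a b)
  rw [Ideal.span_singleton_eq_top.mpr hu, Ideal.absNorm_top] at hn
  exact (Nat.pow_eq_one.mp hn.symm).resolve_right Module.finrank_pos.ne'

end Units

/-! ### Counting ideal classes modulo `P_{K,ℤ}(f)` -/

section Counting
open NumberField NumberField.Units
variable {K : Type*} [Field K]

theorem isPrimeToConductor_span_singleton {f : ℕ} {α : 𝓞 K} :
    IsPrimeToConductor f (Ideal.span {α}) ↔ IsCoprime α (f : 𝓞 K) :=
  Ideal.isCoprime_span_singleton_iff α (f : 𝓞 K)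

/-- The class in `I_K(f)` of a nonzero ideal prime to `f`. -/
noncomputable def idealPrimeToMk [NumberField K] {f : ℕ} (I : Ideal (𝓞 K)) (h0 : I ≠ ⊥)
    (hI : IsPrimeToConductor f I) : idealsPrimeTo K f :=
  ⟨Units.mk0 (I : FractionalIdeal (𝓞 K)⁰ K) (FractionalIdeal.coeIdeal_ne_zero.mpr h0),
    Subgroup.subset_closure ⟨I, hI, rfl⟩⟩

/-- The generators of `P_{K,ℤ}(f)` are closed under multiplication, so its elements are quotients
of two generators. -/
theorem exists_mul_span_eq_span_of_mem_ringClassSubgroup {f : ℕ}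
    {u : (FractionalIdeal (𝓞 K)⁰ K)ˣ} (hu : u ∈ ringClassSubgroup K f) :
    ∃ γ δ : 𝓞 K, γ ∈ orderOfConductor K f ∧ δ ∈ orderOfConductor K f ∧ γ ≠ 0 ∧ δ ≠ 0 ∧
      IsCoprime γ (f : 𝓞 K) ∧ IsCoprime δ (f : 𝓞 K) ∧
      (u : FractionalIdeal (𝓞 K)⁰ K) * (Ideal.span {δ} : Ideal (𝓞 K)) =
        (Ideal.span {γ} : Ideal (𝓞 K)) := by
  induction hu using Subgroup.closure_induction with
  | mem u h =>
    obtain ⟨α, hα, h0, hc, he⟩ := h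
    refine ⟨α, 1, hα, one_mem _, h0, one_ne_zero, isPrimeToConductor_span_singleton.mp hc,
      isCoprime_one_left, ?_⟩
    rw [he]; simp
  | one =>
    exact ⟨1, 1, one_mem _, one_mem _, one_ne_zero, one_ne_zero, isCoprime_one_left,
      isCoprime_one_left, by simp⟩
  | mul u v _ _ hu hv =>
    obtain ⟨γ, δ, h1, h2, h3, h4, h5, h6, h7⟩ := hu
    obtain ⟨γ', δ', g1, g2, g3, g4, g5, g6, g7⟩ := hv
    refine ⟨γ * γ', δ * δ', mul_mem h1 g1, mul_mem h2 g2, mul_ne_zero h3 g3, mul_ne_zero h4 g4,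
      h5.mul_left g5, h6.mul_left g6, ?_⟩
    rw [← Ideal.span_singleton_mul_span_singleton, ← Ideal.span_singleton_mul_span_singleton,
      FractionalIdeal.coeIdeal_mul, FractionalIdeal.coeIdeal_mul, ← h7, ← g7, Units.val_mul]
    ring
  | inv u _ hu =>
    obtain ⟨γ, δ, h1, h2, h3, h4, h5, h6, h7⟩ := hu
    refine ⟨δ, γ, h2, h1, h4, h3, h6, h5, ?_⟩
    rw [← h7, ← mul_assoc, Units.inv_mul, one_mul]

/-- The homomorphism from `𝓞_Kˣ × (ℤ/f)ˣ` to `(𝓞_K/f)ˣ`; residues in the same coset of its image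
generate principal ideals in the same class modulo `P_{K,ℤ}(f)`. -/
noncomputable def unitsProdZModHom (K : Type*) [Field K] (f : ℕ) :
    (𝓞 K)ˣ × (ZMod f)ˣ →* (𝓞 K ⧸ Ideal.span {(f : 𝓞 K)})ˣ :=
  have : ringChar (𝓞 K ⧸ Ideal.span {(f : 𝓞 K)}) ∣ f := by
    refine ringChar.dvd ?_
    rw [← map_natCast (Ideal.Quotient.mk (Ideal.span {(f : 𝓞 K)})), Ideal.Quotient.eq_zero_iff_mem]
    exact Ideal.mem_span_singleton_self _
  (Units.map (Ideal.Quotient.mk (Ideal.span {(f : 𝓞 K)})).toMonoidHom).coprod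
    (Units.map (ZMod.castHom this (𝓞 K ⧸ Ideal.span {(f : 𝓞 K)})).toMonoidHom)

theorem unitsProdZModHom_apply {f : ℕ} (u : (𝓞 K)ˣ) (n : (ZMod f)ˣ) {c : ℤ}
    (hc : (n : ZMod f) = c) :
    (unitsProdZModHom K f (u, n) : 𝓞 K ⧸ Ideal.span {(f : 𝓞 K)}) =
      Ideal.Quotient.mk _ ((u : 𝓞 K) * (c : 𝓞 K)) := by
  simp [unitsProdZModHom, hc]

variable [NumberField K]

/-- The element `(-1, -1)` lies in the kernel, which accounts for the factor `2`. -/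
theorem two_mul_card_range_unitsProdZModHom_le [IsTotallyComplex K]
    (hK : Module.finrank ℚ K = 2) {f : ℕ} (hf : 0 < f) :
    2 * Nat.card (unitsProdZModHom K f).range ≤ torsionOrder K * f.totient := by
  have := finite_units_of_imaginaryQuadratic K hK
  have : NeZero f := ⟨hf.ne'⟩
  have h := Subgroup.card_mul_index (unitsProdZModHom K f).ker
  rw [Subgroup.index_ker, Nat.card_prod, card_units_eq_torsionOrder K hK,
    Nat.card_eq_fintype_card (α := (ZMod f)ˣ),
    ZMod.card_units_eq_totient] at h
  rw [← h]
  refine Nat.mul_le_mul_right _ ?_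
  have hk : ((-1, -1) : (𝓞 K)ˣ × (ZMod f)ˣ) ∈ (unitsProdZModHom K f).ker := by
    rw [MonoidHom.mem_ker, Units.ext_iff, unitsProdZModHom_apply (c := -1) _ _ (by simp)]
    simp
  refine Finite.one_lt_card_iff_nontrivial.mpr ⟨⟨_, hk⟩, 1, fun h => ?_⟩
  have h1 := congrArg
    (fun x : (unitsProdZModHom K f).ker => ((x : (𝓞 K)ˣ × (ZMod f)ˣ).1 : 𝓞 K)) h
  simp only [Units.val_neg, Units.val_one, OneMemClass.coe_one, Prod.fst_one] at h1
  exact absurd h1 (by norm_num)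

/-- Elements of the order `ℤ + f 𝓞_K` prime to `f` reduce to the image of `(ℤ/f)ˣ`. -/
theorem exists_int_of_mem_orderOfConductor {f : ℕ} {γ : 𝓞 K} (hγ : γ ∈ orderOfConductor K f)
    (hc : IsCoprime γ (f : 𝓞 K)) : ∃ (c : ℤ) (n : (ZMod f)ˣ), (n : ZMod f) = c ∧
      Ideal.Quotient.mk (Ideal.span {(f : 𝓞 K)}) γ = Ideal.Quotient.mk _ (c : 𝓞 K) := by
  obtain ⟨c, b, rfl⟩ := hγ
  have h1 : IsCoprime (c : 𝓞 K) (f : 𝓞 K) := (IsCoprime.add_mul_left_left_iff).mp hc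
  have h2 : IsCoprime c (f : ℤ) := isCoprime_of_isCoprime_ringOfIntegers K (by simpa using h1)
  refine ⟨c, ZMod.unitOfIsCoprime c h2, by simp, ?_⟩
  rw [Ideal.Quotient.eq, add_sub_cancel_left]
  exact Ideal.mul_mem_right _ _ (Ideal.mem_span_singleton_self _)

theorem exists_lift_ne_zero {f : ℕ} (hf : 0 < f) (x : (𝓞 K ⧸ Ideal.span {(f : 𝓞 K)})ˣ) :
    ∃ α : 𝓞 K, α ≠ 0 ∧ IsCoprime α (f : 𝓞 K) ∧ Ideal.Quotient.mk _ α =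
      (x : 𝓞 K ⧸ Ideal.span {(f : 𝓞 K)}) := by
  obtain ⟨α, hα⟩ := Ideal.Quotient.mk_surjective (x : 𝓞 K ⧸ Ideal.span {(f : 𝓞 K)})
  have hc : IsCoprime α (f : 𝓞 K) := by
    obtain ⟨β, hβ⟩ := Ideal.Quotient.mk_surjective
      ((x⁻¹ : (𝓞 K ⧸ Ideal.span {(f : 𝓞 K)})ˣ) : 𝓞 K ⧸ Ideal.span {(f : 𝓞 K)})
    have h : Ideal.Quotient.mk (Ideal.span {(f : 𝓞 K)}) (1 - β * α) = 0 := by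
      rw [map_sub, map_mul, hα, hβ, Units.inv_mul, map_one, sub_self]
    obtain ⟨b, hb⟩ := Ideal.mem_span_singleton.mp (Ideal.Quotient.eq_zero_iff_mem.mp h)
    exact ⟨β, b, by linear_combination -hb⟩
  by_cases h0 : α = 0
  · -- the residue class of `0` is a unit only for `f = 1`, and then `f` represents it
    subst h0
    have hf' : IsUnit (f : 𝓞 K) := isCoprime_zero_left.mp hc
    refine ⟨f, by exact_mod_cast hf.ne', isCoprime_self.mpr hf', ?_⟩
    rw [← hα, Ideal.Quotient.eq, sub_zero]
    exact Ideal.mem_span_singleton_self _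
  · exact ⟨α, h0, hc, hα⟩

/-- Let `J i` be ideals prime to `f` in distinct ideal classes. The classes of the ideals `α * J i`
modulo `P_{K,ℤ}(f)`, for `α` in `(𝓞_K/f)ˣ`, are counted by the cosets of the image of
`𝓞_Kˣ × (ℤ/f)ˣ`. This bounds from below the order of any group in which
`I_K(f)/P_{K,ℤ}(f)` embeds. -/
theorem two_mul_card_units_quotient_le [IsTotallyComplex K] (hK : Module.finrank ℚ K = 2)
    {f : ℕ} (hf : 0 < f) {G : Type*} [Group G] [Finite G] (φ : idealsPrimeTo K f →* G)
    (hφ : φ.ker = (ringClassSubgroup K f).subgroupOf (idealsPrimeTo K f))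
    {ι : Type*} [Finite ι] (J : ι → Ideal (𝓞 K)) (hJ0 : ∀ i, J i ≠ ⊥)
    (hJ : ∀ i, IsPrimeToConductor f (J i))
    (hJi : ∀ i j, ∀ α β : 𝓞 K, α ≠ 0 → β ≠ 0 →
      Ideal.span {α} * J i = Ideal.span {β} * J j → i = j) :
    2 * (Nat.card ι * Nat.card (𝓞 K ⧸ Ideal.span {(f : 𝓞 K)})ˣ) ≤
      Nat.card G * (torsionOrder K * f.totient) := by
  classical
  have hne : Ideal.span {(f : 𝓞 K)} ≠ ⊥ := by
    simpa [Ideal.span_singleton_eq_bot] using hf.ne'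
  have := finite_quotient_of_ne_bot hne
  choose α hα0 hαc hα using exists_lift_ne_zero (K := K) hf
  have hne' (i : ι) (x) : Ideal.span {α x} * J i ≠ ⊥ :=
    mul_ne_zero (by simpa [Ideal.span_singleton_eq_bot] using hα0 x) (hJ0 i)
  have hco (i : ι) (x) : IsPrimeToConductor f (Ideal.span {α x} * J i) :=
    IsCoprime.mul_left (isPrimeToConductor_span_singleton.mpr (hαc x)) (hJ i)
  let Φ : ι × (𝓞 K ⧸ Ideal.span {(f : 𝓞 K)})ˣ → G := fun z =>
    φ (idealPrimeToMk _ (hne' z.1 z.2) (hco z.1 z.2))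
  have key (i j : ι) (x y) (h : Φ (i, x) = Φ (j, y)) :
      i = j ∧ x * y⁻¹ ∈ (unitsProdZModHom K f).range := by
    have hmem : idealPrimeToMk _ (hne' i x) (hco i x) * (idealPrimeToMk _ (hne' j y) (hco j y))⁻¹
        ∈ φ.ker := by
      rw [MonoidHom.mem_ker, map_mul, map_inv, mul_inv_eq_one]; exact h
    rw [hφ, Subgroup.mem_subgroupOf] at hmem
    obtain ⟨γ, δ, h1, h2, h3, h4, h5, h6, h7⟩ :=
      exists_mul_span_eq_span_of_mem_ringClassSubgroup hmem
    have h8 : Ideal.span {α x * δ} * J i = Ideal.span {α y * γ} * J j := by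
      rw [← FractionalIdeal.coeIdeal_inj (K := K), ← Ideal.span_singleton_mul_span_singleton,
        ← Ideal.span_singleton_mul_span_singleton]
      have hy : (((idealPrimeToMk _ (hne' j y) (hco j y) : idealsPrimeTo K f) :
          (FractionalIdeal (𝓞 K)⁰ K)ˣ) : FractionalIdeal (𝓞 K)⁰ K) =
          (Ideal.span {α y} * J j : Ideal (𝓞 K)) := rfl
      have hx : (((idealPrimeToMk _ (hne' i x) (hco i x) : idealsPrimeTo K f) :
          (FractionalIdeal (𝓞 K)⁰ K)ˣ) : FractionalIdeal (𝓞 K)⁰ K) =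
          (Ideal.span {α x} * J i : Ideal (𝓞 K)) := rfl
      simp only [Subgroup.coe_mul, Subgroup.coe_inv, Units.val_mul] at h7
      have h9 := congrArg (fun t => t * (((idealPrimeToMk _ (hne' j y) (hco j y) :
        idealsPrimeTo K f) : (FractionalIdeal (𝓞 K)⁰ K)ˣ) : FractionalIdeal (𝓞 K)⁰ K)) h7
      rw [mul_right_comm, mul_assoc (_ : FractionalIdeal (𝓞 K)⁰ K) (Units.val _⁻¹) (Units.val _),
        Units.inv_mul, mul_one, hx, hy] at h9
      simp only [FractionalIdeal.coeIdeal_mul] at h9 ⊢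
      rw [mul_right_comm, h9]
      ring
    obtain rfl := hJi i j _ _ (mul_ne_zero (hα0 x) h4) (mul_ne_zero (hα0 y) h3) h8
    refine ⟨rfl, ?_⟩
    have h10 := mul_right_cancel₀ (hJ0 i) h8
    obtain ⟨u, hu⟩ := Ideal.span_singleton_eq_span_singleton.mp h10.symm
    obtain ⟨c, n, hn, hc⟩ := exists_int_of_mem_orderOfConductor h1 h5
    obtain ⟨d, m, hm, hd⟩ := exists_int_of_mem_orderOfConductor h2 h6
    refine ⟨(u, n) * (1, m)⁻¹, ?_⟩
    rw [map_mul, map_inv, mul_inv_eq_iff_eq_mul, mul_right_comm, eq_comm, mul_inv_eq_iff_eq_mul,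
      Units.ext_iff, Units.val_mul, Units.val_mul, unitsProdZModHom_apply u n hn,
      unitsProdZModHom_apply 1 m hm, ← hα x, ← hα y]
    have h11 := congrArg (Ideal.Quotient.mk (Ideal.span {(f : 𝓞 K)})) hu
    simp only [map_mul, hc, hd, Units.val_one, one_mul] at h11 ⊢
    linear_combination -h11
  have : Fintype ι := Fintype.ofFinite ι
  have : Fintype (𝓞 K ⧸ Ideal.span {(f : 𝓞 K)})ˣ := Fintype.ofFinite _
  have : Fintype G := Fintype.ofFinite G
  have : Fintype (unitsProdZModHom K f).range := Fintype.ofFinite _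
  have hcard := Finset.card_le_mul_card_image_of_maps_to
    (f := Φ) (s := Finset.univ) (t := Finset.univ) (fun _ _ => Finset.mem_univ _)
    (Nat.card (unitsProdZModHom K f).range) (fun b _ => by
      rcases Finset.eq_empty_or_nonempty ({a ∈ Finset.univ | Φ a = b}) with h0 | ⟨⟨j, y⟩, hjy⟩
      · rw [h0]; simp
      · rw [Finset.mem_filter] at hjy
        have hsub : Finset.filter (fun a => Φ a = b) Finset.univ ⊆
            Finset.image
              (fun h : (unitsProdZModHom K f).range =>
                (j, (h : (𝓞 K ⧸ Ideal.span {(f : 𝓞 K)})ˣ) * y)) Finset.univ := by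
          rintro ⟨i, x⟩ hix
          rw [Finset.mem_filter] at hix
          obtain ⟨rfl, hr⟩ := key i j x y (hix.2.trans hjy.2.symm)
          exact Finset.mem_image.mpr ⟨⟨_, hr⟩, Finset.mem_univ _, by simp⟩
        refine (Finset.card_le_card hsub).trans (Finset.card_image_le.trans ?_)
        rw [Finset.card_univ, Nat.card_eq_fintype_card])
  rw [Finset.card_univ, Finset.card_univ, ← Nat.card_eq_fintype_card, ← Nat.card_eq_fintype_card,
    Nat.card_prod] at hcard
  have h2 := two_mul_card_range_unitsProdZModHom_le (K := K) hK hf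
  nlinarith [Nat.mul_le_mul_left (Nat.card G) h2]

end Counting

/-! ### Multiplicative lower bounds -/

section MultiplicativeBound

/-- Lower bounds `c`, and `c ^ 2` off an exceptional set `E`, for a multiplicative function on the
prime powers dividing `f` give the same bounds at `f`. -/
theorem lowerBound_of_primePow {q : ℕ → ℝ}
    (hm : ∀ a b : ℕ, a.Coprime b → q (a * b) = q a * q b) {c : ℝ} (hc : 1 ≤ c) (E : Set ℕ)
    {f : ℕ} (hf : f ≠ 0) (h : ∀ p k : ℕ, p.Prime → p ^ (k + 1) ∣ f →
      c ≤ q (p ^ (k + 1)) ∧ (p ^ (k + 1) ∈ E ∨ c ^ 2 ≤ q (p ^ (k + 1)))) :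
    f = 1 ∨ (c ≤ q f ∧ (f ∈ E ∨ c ^ 2 ≤ q f)) := by
  induction f using Nat.recOnPosPrimePosCoprime with
  | zero => exact absurd rfl hf
  | one => exact Or.inl rfl
  | prime_pow p n hp hn =>
    obtain ⟨k, rfl⟩ := Nat.exists_eq_succ_of_ne_zero hn.ne'
    exact Or.inr (h p k hp dvd_rfl)
  | coprime a b ha hb hab iha ihb =>
    have ha' := iha (by omega) fun p k hp hd => h p k hp (hd.mul_right b)
    have hb' := ihb (by omega) fun p k hp hd => h p k hp (hd.mul_left a)
    rcases ha' with rfl | ⟨ha', -⟩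
    · omega
    rcases hb' with rfl | ⟨hb', -⟩
    · omega
    right
    rw [hm a b hab]
    have : c ^ 2 ≤ q a * q b := by nlinarith
    exact ⟨by nlinarith, Or.inr this⟩

theorem le_totient_sq_of_odd {m : ℕ} (hm : Odd m) : m ≤ m.totient ^ 2 := by
  have h := lowerBound_of_primePow (q := fun n => (n.totient : ℝ) ^ 2 / n)
    (fun a b hab => by simp only [Nat.totient_mul hab]; push_cast; rw [mul_pow]; ring_nf) le_rfl
    Set.univ hm.pos.ne' (fun p k hp hd => ⟨?_, Or.inl trivial⟩)
  · rcases h with rfl | ⟨h, -⟩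
    · simp
    · rw [le_div_iff₀ (by exact_mod_cast hm.pos), one_mul] at h
      exact_mod_cast h
  · have hp3 : 3 ≤ p := by
      have h2 : p ≠ 2 := by
        rintro rfl
        exact (Nat.not_even_iff_odd.mpr hm) (even_iff_two_dvd.mpr
          ((dvd_pow_self 2 k.succ_ne_zero).trans hd))
      have := hp.two_le
      omega
    have hpp : 0 < p ^ (k + 1) := pow_pos hp.pos _
    rw [le_div_iff₀ (by exact_mod_cast hpp), one_mul, Nat.totient_prime_pow_succ hp]
    have h4 : p ≤ (p - 1) ^ 2 := by
      obtain ⟨r, rfl⟩ := Nat.exists_eq_add_of_le hp3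
      rw [show 3 + r - 1 = r + 2 by omega]
      nlinarith
    have : p ^ (k + 1) ≤ (p ^ k * (p - 1)) ^ 2 := by
      rw [pow_succ, mul_pow]
      exact Nat.mul_le_mul (Nat.le_self_pow two_ne_zero _) h4
    exact_mod_cast this

/-- The possible numbers of roots of unity in a quadratic field. -/
theorem eq_of_even_of_totient_le_two {w : ℕ} (hw : w ≠ 0) (he : Even w) (ht : w.totient ≤ 2) :
    w = 2 ∨ w = 4 ∨ w = 6 := by
  obtain ⟨a, m, hm, rfl⟩ := Nat.exists_eq_two_pow_mul_odd hw
  have hco : Nat.Coprime (2 ^ a) m := (Nat.coprime_two_left.mpr hm).pow_left a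
  obtain ⟨b, rfl⟩ : ∃ b, a = b + 1 := by
    refine Nat.exists_eq_succ_of_ne_zero ?_
    rintro rfl
    exact Nat.not_even_iff_odd.mpr hm (by simpa using he)
  rw [Nat.totient_mul hco, Nat.totient_prime_pow_succ Nat.prime_two] at ht
  have h1 := le_totient_sq_of_odd hm
  have hb : 0 < 2 ^ b := by positivity
  have hmt : 0 < m.totient := Nat.totient_pos.mpr hm.pos
  have h2 : m.totient ≤ 2 := by nlinarith
  have h3 : 2 ^ b ≤ 2 := by nlinarith
  have h4 : b ≤ 1 := (Nat.pow_le_pow_iff_right one_lt_two).mp (by simpa using h3)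
  have h5 : m ≤ 4 := by nlinarith
  interval_cases m
  · simp at hm
  · interval_cases b <;> simp
  · exact absurd hm (by decide)
  · rw [Nat.totient_prime Nat.prime_three] at ht
    interval_cases b
    · simp
    · simp at ht
  · exact absurd hm (by decide)

end MultiplicativeBound

/-! ### Integers and roots of unity of an imaginary quadratic field -/

section QuadraticField
open NumberField NumberField.Units
variable {K : Type*} [Field K]

theorem exists_ringOfIntegers_sq_eq {x : K} {m : ℤ} (hx : x ^ 2 = m) : ∃ y : 𝓞 K, y ^ 2 = m := by
  have hi : IsIntegral ℤ x := by
    refine IsIntegral.of_pow two_pos ?_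
    rw [hx]
    exact isIntegral_algebraMap (x := m)
  obtain ⟨y, rfl⟩ : ∃ y : 𝓞 K, algebraMap (𝓞 K) K y = x := ⟨⟨x, hi⟩, rfl⟩
  refine ⟨y, RingOfIntegers.coe_injective ?_⟩
  rw [map_pow, map_intCast]
  exact hx

theorem exists_ringOfIntegers_sq_add_add_one {ζ : K} (hζ : IsPrimitiveRoot ζ 3) :
    ∃ y : 𝓞 K, y ^ 2 + y + 1 = 0 := by
  refine ⟨hζ.toInteger, ?_⟩
  have h := hζ.toInteger_isPrimitiveRoot.geom_sum_eq_zero (by norm_num)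
  simp only [Finset.sum_range_succ, Finset.sum_range_zero] at h
  linear_combination h

variable [NumberField K]

/-- Here `t` and `n` are the trace and the norm of `α`; the discriminant `t ^ 2 - 4 n` is not positive
because the two embeddings of `K` are complex conjugate. -/
theorem exists_sq_eq_of_imaginaryQuadratic [IsTotallyComplex K] (hK : Module.finrank ℚ K = 2)
    (α : 𝓞 K) : ∃ t n : ℤ, α ^ 2 = t * α - n ∧ t ^ 2 ≤ 4 * n ∧
      n.natAbs = Ideal.absNorm (Ideal.span {α}) := by
  obtain ⟨σ⟩ : Nonempty (K →ₐ[ℚ] ℂ) := ⟨IsAlgClosed.lift⟩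
  let τ : K →ₐ[ℚ] ℂ := (Complex.conjAe.toAlgHom.restrictScalars ℚ).comp σ
  have hτ (x : K) : τ x = (starRingEnd ℂ) (σ x) := rfl
  have hne : σ ≠ τ := by
    intro h
    refine IsTotallyComplex.complexEmbedding_not_isReal (σ : K →+* ℂ) (RingHom.ext fun x => ?_)
    exact (DFunLike.congr_fun h x).symm
  classical
  have huniv : ({σ, τ} : Finset (K →ₐ[ℚ] ℂ)) = Finset.univ := by
    refine Finset.eq_univ_of_card _ ?_
    rw [Finset.card_pair hne, AlgHom.card, hK]
  have hn := Algebra.norm_eq_prod_embeddings ℚ ℂ (α : K)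
  have ht := trace_eq_sum_embeddings (K := ℚ) ℂ (x := (α : K))
  rw [← huniv, Finset.prod_pair hne, hτ, ← Algebra.coe_norm_int] at hn
  rw [← huniv, Finset.sum_pair hne, hτ, ← Algebra.coe_trace_int] at ht
  simp only [map_intCast] at hn ht
  refine ⟨Algebra.trace ℤ (𝓞 K) α, Algebra.norm ℤ α, ?_, ?_, ?_⟩
  · refine RingOfIntegers.coe_injective ((σ : K →+* ℂ).injective ?_)
    simp only [map_pow, map_sub, map_mul, map_intCast]
    change σ α ^ 2 = _ * σ α - _
    rw [hn, ht]; ring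
  · have hn' : ((Algebra.norm ℤ α : ℤ) : ℝ) = (σ α).re ^ 2 + (σ α).im ^ 2 := by
      have := congrArg Complex.re hn
      simp only [Complex.intCast_re, Complex.mul_re, Complex.conj_re, Complex.conj_im] at this
      rw [this]; ring
    have ht' : ((Algebra.trace ℤ (𝓞 K) α : ℤ) : ℝ) = 2 * (σ α).re := by
      have := congrArg Complex.re ht
      simp only [Complex.intCast_re, Complex.add_re, Complex.conj_re] at this
      rw [this]; ring
    have : ((Algebra.trace ℤ (𝓞 K) α : ℤ) : ℝ) ^ 2 ≤ 4 * (Algebra.norm ℤ α : ℤ) := by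
      rw [hn', ht']; nlinarith [sq_nonneg (σ α).im]
    exact_mod_cast this
  · rw [Ideal.absNorm_span_singleton]

/-- An imaginary quadratic field contains no irrational square root of a positive integer. -/
theorem exists_sq_eq_four_mul_of_sq_eq [IsTotallyComplex K] (hK : Module.finrank ℚ K = 2)
    {z : 𝓞 K} {d : ℤ} (hd : 0 < d) (hz : z ^ 2 = d) : ∃ t : ℤ, t ^ 2 = 4 * d := by
  obtain ⟨t, n, h, hle, -⟩ := exists_sq_eq_of_imaginaryQuadratic hK z
  have h1 : (t : 𝓞 K) * z = ((d + n : ℤ) : 𝓞 K) := by push_cast; linear_combination hz - h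
  have h2 : t ^ 2 * d = (d + n) ^ 2 := by
    have : ((t ^ 2 * d : ℤ) : 𝓞 K) = ((d + n) ^ 2 : ℤ) := by
      push_cast at h1 ⊢
      linear_combination ((t : 𝓞 K) * z + (d + n)) * h1 - t ^ 2 * hz
    exact_mod_cast this
  -- `(d + n) ^ 2 = t ^ 2 * d ≤ 4 * n * d` forces `n = d`
  have h3 : n = d := by nlinarith [sq_nonneg (n - d)]
  exact ⟨t, by subst h3; nlinarith⟩

theorem torsionOrder_cases (hK : Module.finrank ℚ K = 2) :
    torsionOrder K = 2 ∨ (torsionOrder K = 4 ∧ ∃ x : K, x ^ 2 = -1) ∨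
      (torsionOrder K = 6 ∧ ∃ ζ : K, IsPrimitiveRoot ζ 3) := by
  obtain ⟨g, hg⟩ := IsCyclic.exists_generator (α := torsion K)
  have hprim : IsPrimitiveRoot ((g : (𝓞 K)ˣ) : 𝓞 K) (torsionOrder K) := by
    rw [IsPrimitiveRoot.coe_units_iff, IsPrimitiveRoot.coe_submonoidClass_iff]
    have := IsPrimitiveRoot.orderOf g
    rwa [orderOf_eq_card_of_forall_mem_zpowers hg] at this
  have h1 := hprim.totient_le_degree_minpoly.trans (minpoly.natDegree_le _)
  rw [RingOfIntegers.rank, hK] at h1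
  have hprim' : IsPrimitiveRoot (((g : (𝓞 K)ˣ) : 𝓞 K) : K) (torsionOrder K) :=
    hprim.map_of_injective RingOfIntegers.coe_injective
  rcases eq_of_even_of_totient_le_two (torsionOrder_ne_zero K) (even_torsionOrder K) h1
    with h | h | h
  · exact Or.inl h
  · refine Or.inr (Or.inl ⟨h, (((g : (𝓞 K)ˣ) : 𝓞 K) : K), ?_⟩)
    rw [h] at hprim'
    exact (hprim'.pow (by norm_num) (show 4 = 2 * 2 by norm_num)).eq_neg_one_of_two_right
  · refine Or.inr (Or.inr ⟨h, (((g : (𝓞 K)ˣ) : 𝓞 K) : K) ^ 2, ?_⟩)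
    rw [h] at hprim'
    exact hprim'.pow (by norm_num) (by norm_num)

theorem torsionOrder_eq_four (hK : Module.finrank ℚ K = 2) {x : K} (hx : x ^ 2 = -1) :
    torsionOrder K = 4 := by
  have h4 : IsPrimitiveRoot x 4 := by
    have : orderOf x = 2 ^ (1 + 1) := orderOf_eq_prime_pow
      (by rw [pow_one, hx]; norm_num) (by rw [pow_succ, pow_one, pow_mul, hx]; norm_num)
    have h := IsPrimitiveRoot.orderOf x
    rwa [this] at h
  have := dvd_torsionOrder_of_isPrimitiveRoot h4
  rcases torsionOrder_cases hK with h | ⟨h, -⟩ | ⟨h, -⟩ <;> rw [h] at this ⊢ <;> omega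

theorem torsionOrder_eq_six (hK : Module.finrank ℚ K = 2) {ζ : K} (hζ : IsPrimitiveRoot ζ 3) :
    torsionOrder K = 6 := by
  have := dvd_torsionOrder_of_isPrimitiveRoot hζ
  rcases torsionOrder_cases hK with h | ⟨h, -⟩ | ⟨h, -⟩ <;> rw [h] at this ⊢ <;> omega

/-- Together with `√-7`, a fourth or a third root of unity would produce `√7` or `√21` in `K`. -/
theorem torsionOrder_eq_two_of_sq_eq_neg_seven [IsTotallyComplex K]
    (hK : Module.finrank ℚ K = 2) {x : K} (hx : x ^ 2 = -7) : torsionOrder K = 2 := by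
  obtain ⟨y, hy⟩ := exists_ringOfIntegers_sq_eq (x := x) (m := -7) (by simpa using hx)
  have key {d : ℤ} (hd : 0 < d) (hd' : d ≤ 21) (hs : ∃ z : 𝓞 K, z ^ 2 = d)
      (h : ∀ t : ℤ, -10 < t → t < 10 → t ^ 2 ≠ 4 * d) : False := by
    obtain ⟨z, hz⟩ := hs
    obtain ⟨t, ht⟩ := exists_sq_eq_four_mul_of_sq_eq hK hd hz
    exact h t (by nlinarith) (by nlinarith) ht
  rcases torsionOrder_cases hK with h | ⟨-, i, hi⟩ | ⟨-, ζ, hζ⟩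
  · exact h
  · obtain ⟨j, hj⟩ := exists_ringOfIntegers_sq_eq (x := i) (m := -1) (by simpa using hi)
    refine (key (d := 7) (by norm_num) (by norm_num) ⟨y * j, ?_⟩ ?_).elim
    · rw [mul_pow, hy, hj]; norm_num
    · intro t h1 h2; interval_cases t <;> norm_num
  · obtain ⟨j, hj⟩ := exists_ringOfIntegers_sq_add_add_one hζ
    refine (key (d := 21) (by norm_num) (by norm_num) ⟨y * (2 * j + 1), ?_⟩ ?_).elim
    · rw [mul_pow, hy]; push_cast; linear_combination -28 * hj
    · intro t h1 h2; interval_cases t <;> norm_num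

end QuadraticField

/-! ### The ratio `ψ(f) ^ 2 / f` and its values at primes -/

section UnitRatio
open NumberField
variable (K : Type*) [Field K]

/-- The ratio `ψ(f) ^ 2 / f`, where `ψ(f) = #(𝓞_K/f)ˣ / #(ℤ/f)ˣ` is the relative class number
`h(𝓞_f) / h(𝓞_K)` multiplied by the unit index. -/
noncomputable def unitRatio (f : ℕ) : ℝ :=
  (Nat.card (𝓞 K ⧸ Ideal.span {(f : 𝓞 K)})ˣ : ℝ) ^ 2 / ((f.totient : ℝ) ^ 2 * f)

variable {K}

theorem le_unitRatio_prime {p : ℕ} (hp : p.Prime) {m : ℕ}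
    (h : m * (p - 1) ≤ Nat.card (𝓞 K ⧸ Ideal.span {(p : 𝓞 K)})ˣ) :
    (m : ℝ) ^ 2 / p ≤ unitRatio K p := by
  have h1 : (0 : ℝ) < p := by exact_mod_cast hp.pos
  have h2 : (0 : ℝ) < ((p - 1 : ℕ) : ℝ) := by
    have := hp.one_lt
    exact_mod_cast (by omega : 0 < p - 1)
  rw [unitRatio, Nat.totient_prime hp, div_le_div_iff₀ h1 (by positivity)]
  have h3 : (m : ℝ) * ((p - 1 : ℕ) : ℝ) ≤ (Nat.card (𝓞 K ⧸ Ideal.span {(p : 𝓞 K)})ˣ : ℝ) := by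
    exact_mod_cast h
  have h4 : ((m : ℝ) * ((p - 1 : ℕ) : ℝ)) ^ 2 ≤
      (Nat.card (𝓞 K ⧸ Ideal.span {(p : 𝓞 K)})ˣ : ℝ) ^ 2 := by gcongr
  nlinarith

theorem unitRatio_mul (a b : ℕ) (h : a.Coprime b) :
    unitRatio K (a * b) = unitRatio K a * unitRatio K b := by
  have hc : IsCoprime (Ideal.span {(a : 𝓞 K)}) (Ideal.span {(b : 𝓞 K)}) := by
    rw [Ideal.isCoprime_span_singleton_iff]
    simpa using h.isCoprime.map (Int.castRingHom (𝓞 K))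
  have hr := card_units_quotient_mul hc
  rw [Ideal.span_singleton_mul_span_singleton, ← Nat.cast_mul] at hr
  simp only [unitRatio, hr, Nat.cast_mul, Nat.totient_mul h]
  rw [div_mul_div_comm]
  congr 1
  · ring
  · ring

variable [NumberField K]

theorem unitRatio_prime_pow (hK : Module.finrank ℚ K = 2) {p : ℕ} (hp : p.Prime) (k : ℕ) :
    unitRatio K (p ^ (k + 1)) = unitRatio K p * p ^ k := by
  have hp0 : Ideal.span {(p : 𝓞 K)} ≠ ⊥ := by
    simpa [Ideal.span_singleton_eq_bot] using hp.ne_zero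
  have h := card_units_quotient_pow hp0 k
  rw [Ideal.span_singleton_pow, ← Nat.cast_pow, Ideal.absNorm_span_natCast, RingOfIntegers.rank, hK] at h
  have h1 : (p : ℝ) ≠ 0 := by exact_mod_cast hp.ne_zero
  have h2 : ((p - 1 : ℕ) : ℝ) ≠ 0 := by
    have := hp.one_lt
    exact_mod_cast (by omega : p - 1 ≠ 0)
  simp only [unitRatio, h, Nat.totient_prime_pow_succ hp, Nat.totient_prime hp, Nat.cast_mul,
    Nat.cast_pow]
  field_simp
  ring

theorem sub_one_mul_self_le {p : ℕ} (hp : p.Prime) :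
    (p - 1) * p ≤ p ^ 2 - 1 := by
  obtain ⟨r, rfl⟩ := Nat.exists_eq_add_of_le hp.one_lt.le
  rw [Nat.add_sub_cancel_left]
  refine Nat.le_sub_of_add_le ?_
  nlinarith

theorem sub_one_sq_div_le_unitRatio (hK : Module.finrank ℚ K = 2) {p : ℕ} (hp : p.Prime) :
    ((p : ℝ) - 1) ^ 2 / p ≤ unitRatio K p := by
  have h1 := sub_one_mul_self_le hp
  have h2 : (p - 1) * (p - 1) ≤ (p - 1) * p := Nat.mul_le_mul_left _ (Nat.sub_le _ _)
  have := le_unitRatio_prime (K := K) hp (m := p - 1) ?_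
  · rwa [Nat.cast_sub hp.one_lt.le, Nat.cast_one] at this
  · rcases card_units_quotient_prime ((RingOfIntegers.rank K).trans hK) hp with
      h | ⟨_, _, _, _, h⟩ | ⟨_, _, _, _, _, _, _, _, h⟩ <;> rw [h]
    · exact h2.trans h1
    · exact h2
    · rw [sq]

/-- The factor at a prime is at least `p` unless `p` splits. -/
theorem le_unitRatio_or_split (hK : Module.finrank ℚ K = 2) {p : ℕ} (hp : p.Prime) :
    (p : ℝ) ≤ unitRatio K p ∨ ∃ P Q : Ideal (𝓞 K), P.IsMaximal ∧ Q.IsMaximal ∧ P ≠ Q ∧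
      Ideal.absNorm P = p ∧ Ideal.absNorm Q = p ∧ Ideal.span {(p : 𝓞 K)} = P * Q := by
  have h0 : (p : ℝ) ≠ 0 := by exact_mod_cast hp.ne_zero
  have key (h : p * (p - 1) ≤ Nat.card (𝓞 K ⧸ Ideal.span {(p : 𝓞 K)})ˣ) :
      (p : ℝ) ≤ unitRatio K p := by
    have := le_unitRatio_prime hp h
    rwa [sq, mul_div_cancel_right₀ _ h0] at this
  rcases card_units_quotient_prime ((RingOfIntegers.rank K).trans hK) hp with
    h | ⟨_, _, _, _, h⟩ | ⟨P, Q, h1, h2, h3, h4, h5, h6, -⟩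
  · exact Or.inl (key (by rw [h, mul_comm]; exact sub_one_mul_self_le hp))
  · exact Or.inl (key (by rw [h, mul_comm]))
  · exact Or.inr ⟨P, Q, h1, h2, h3, h4, h5, h6⟩

/-- If `p` splits, the residue field of a prime above `p` is `ZMod p`. -/
theorem le_unitRatio_of_isEmpty_ringHom (hK : Module.finrank ℚ K = 2) {p : ℕ} (hp : p.Prime)
    (h : IsEmpty (𝓞 K →+* ZMod p)) : (p : ℝ) ≤ unitRatio K p := by
  rcases le_unitRatio_or_split hK hp with h' | ⟨P, _, _, _, _, hP, _⟩
  · exact h'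
  · exact (not_isEmpty_iff.mpr (nonempty_ringHom_zmod_of_absNorm_eq hp hP) h).elim

/-- If `p` splits, then `𝓞_K/p` is reduced. -/
theorem le_unitRatio_of_dvd_sq (hK : Module.finrank ℚ K = 2) {p : ℕ} (hp : p.Prime) {x : 𝓞 K}
    (h : (p : 𝓞 K) ∣ x ^ 2) (hx : ¬ (p : 𝓞 K) ∣ x) : (p : ℝ) ≤ unitRatio K p := by
  rcases le_unitRatio_or_split hK hp with h' | ⟨P, Q, hP, hQ, hne, _, _, hPQ⟩
  · exact h'
  · refine absurd ?_ hx
    have h1 : x ^ 2 ∈ P * Q := hPQ ▸ Ideal.mem_span_singleton.mpr h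
    rw [← Ideal.mem_span_singleton, hPQ,
      Ideal.mul_eq_inf_of_isCoprime (Ideal.isCoprime_of_isMaximal hne)]
    exact ⟨hP.isPrime.mem_of_pow_mem 2 (Ideal.mul_le_left h1),
      hQ.isPrime.mem_of_pow_mem 2 (Ideal.mul_le_right h1)⟩

/-- A primitive cube root of unity would reduce to a root of `X ^ 2 + X + 1` in a residue field with
two elements, so `2` is inert. -/
theorem le_unitRatio_two_of_sq_add_add_one (hK : Module.finrank ℚ K = 2) {z : 𝓞 K}
    (hz : z ^ 2 + z + 1 = 0) : (9 / 2 : ℝ) ≤ unitRatio K 2 := by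
  have he : ¬ ∃ P : Ideal (𝓞 K), Ideal.absNorm P = 2 := by
    rintro ⟨P, hP⟩
    obtain ⟨φ⟩ := nonempty_ringHom_zmod_of_absNorm_eq Nat.prime_two hP
    have h := congrArg φ hz
    simp only [map_add, map_pow, map_one, map_zero] at h
    generalize φ z = y at h
    revert y; decide
  have := le_unitRatio_prime (K := K) Nat.prime_two (m := 3) ?_
  · norm_num at this ⊢; exact this
  · rcases card_units_quotient_prime ((RingOfIntegers.rank K).trans hK) Nat.prime_two with
      h | ⟨P, _, hP, _⟩ | ⟨P, _, _, _, _, hP, _⟩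
    · rw [h]; norm_num
    · exact absurd ⟨P, hP⟩ he
    · exact absurd ⟨P, hP⟩ he

theorem not_natCast_dvd_one {p : ℕ} (hp : p.Prime) : ¬ (p : 𝓞 K) ∣ 1 := by
  intro h
  have hn := Ideal.absNorm_span_natCast (S := 𝓞 K) p
  rw [Ideal.span_singleton_eq_top.mpr (isUnit_of_dvd_one h), Ideal.absNorm_top] at hn
  exact hp.ne_one ((Nat.pow_eq_one.mp hn.symm).resolve_right Module.finrank_pos.ne')

/-- The element `1 + z` has square `2 z`, so `2` ramifies. -/
theorem le_unitRatio_two_of_sq_eq_neg_one (hK : Module.finrank ℚ K = 2) {z : 𝓞 K}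
    (hz : z ^ 2 = -1) : (2 : ℝ) ≤ unitRatio K 2 := by
  refine mod_cast le_unitRatio_of_dvd_sq hK Nat.prime_two (x := 1 + z) ⟨z, ?_⟩ ?_
  · push_cast; linear_combination hz
  · rintro ⟨c, hc⟩
    refine not_natCast_dvd_one (K := K) Nat.prime_two ⟨-c ^ 2 * z, ?_⟩
    have : (2 : 𝓞 K) * (z - 2 * c ^ 2) = 0 := by
      push_cast at hc; linear_combination (1 + z + 2 * c) * hc - hz
    have h2 : z - 2 * c ^ 2 = 0 := (mul_eq_zero.mp this).resolve_left two_ne_zero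
    push_cast
    linear_combination -z * h2 + hz

/-- A nonresidue modulo `3` that is a square in `𝓞_K` prevents `3` from splitting. -/
theorem le_unitRatio_three_of_sq_eq (hK : Module.finrank ℚ K = 2) {z : 𝓞 K} {m : ℤ}
    (hm : m % 3 = 2) (hz : z ^ 2 = m) : (3 : ℝ) ≤ unitRatio K 3 := by
  refine mod_cast le_unitRatio_of_isEmpty_ringHom hK Nat.prime_three ⟨fun φ => ?_⟩
  have h := congrArg φ hz
  have hm' : (m : ZMod 3) = 2 := by
    rw [← Int.emod_add_mul_ediv m 3, hm]
    push_cast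
    rw [show (3 : ZMod 3) = 0 from rfl]; ring
  rw [map_pow, map_intCast, hm'] at h
  generalize φ z = y at h
  revert y; decide

/-- The element `1 - z` has square `-3 z`, so `3` ramifies. -/
theorem le_unitRatio_three_of_sq_add_add_one (hK : Module.finrank ℚ K = 2) {z : 𝓞 K}
    (hz : z ^ 2 + z + 1 = 0) : (3 : ℝ) ≤ unitRatio K 3 := by
  refine mod_cast le_unitRatio_of_dvd_sq hK Nat.prime_three (x := 1 - z) ⟨-z, ?_⟩ ?_
  · push_cast; linear_combination hz
  · rintro ⟨c, hc⟩
    refine not_natCast_dvd_one (K := K) Nat.prime_three ⟨-c ^ 2 * z ^ 2, ?_⟩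
    have : (3 : 𝓞 K) * (z + 3 * c ^ 2) = 0 := by
      push_cast at hc; linear_combination -(1 - z + 3 * c) * hc + hz
    have h2 : z + 3 * c ^ 2 = 0 := (mul_eq_zero.mp this).resolve_left (by norm_num)
    push_cast
    linear_combination z ^ 2 * h2 - (z - 1) * hz

end UnitRatio

/-! ### Nonprincipal ideals prime to the conductor -/

section NonprincipalIdeal
open NumberField
variable {K : Type*} [Field K] [NumberField K]

/-- Every nonprincipal ideal has a multiple `α = P * A` with `A` prime to `f`; then `A` is not
principal either. -/
theorem exists_not_isPrincipal_isPrimeToConductor {f : ℕ} (hf : 0 < f) {P : Ideal (𝓞 K)}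
    (hP : ¬ P.IsPrincipal) :
    ∃ A : Ideal (𝓞 K), A ≠ ⊥ ∧ IsPrimeToConductor f A ∧ ¬ A.IsPrincipal := by
  have hP0 : P ≠ ⊥ := by rintro rfl; exact hP bot_isPrincipal
  have hf0 : Ideal.span {(f : 𝓞 K)} ≠ ⊥ := by
    simpa [Ideal.span_singleton_eq_bot] using hf.ne'
  obtain ⟨a, ha⟩ := IsDedekindDomain.exists_sup_span_eq
    (Ideal.mul_le_left : P * Ideal.span {(f : 𝓞 K)} ≤ P) (mul_ne_zero hP0 hf0)
  have hdvd : P ∣ Ideal.span {a} := Ideal.dvd_iff_le.mpr (ha ▸ le_sup_right)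
  obtain ⟨A, hA⟩ := hdvd
  have hco : Ideal.span {(f : 𝓞 K)} ⊔ A = ⊤ := by
    rw [hA, ← Ideal.mul_sup] at ha
    exact mul_left_cancel₀ hP0 (ha.trans (Ideal.mul_top P).symm)
  have hcop : IsPrimeToConductor f A := (Ideal.isCoprime_iff_sup_eq.mpr hco).symm
  by_cases hA0 : A = ⊥
  · refine ⟨P, hP0, ?_, hP⟩
    rw [hA0, sup_bot_eq] at hco
    rw [IsPrimeToConductor, hco, ← Ideal.one_eq_top]
    exact isCoprime_one_right
  · refine ⟨A, hA0, hcop, ?_⟩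
    rintro ⟨b, hb⟩
    change A = Ideal.span {b} at hb
    have hab : a ∈ Ideal.span {b} := by
      rw [← hb]; exact Ideal.mul_le_right (hA ▸ Ideal.mem_span_singleton_self a)
    obtain ⟨c, rfl⟩ := Ideal.mem_span_singleton.mp hab
    rw [← Ideal.span_singleton_mul_span_singleton, mul_comm P, ← hb] at hA
    exact hP ⟨c, (mul_left_cancel₀ hA0 hA).symm⟩

/-- An element of norm `2` that generates a split prime is a root of `X ^ 2 ± X + 2`, whose
discriminant is `-7`. -/
theorem exists_sq_eq_neg_seven_of_isPrincipal [IsTotallyComplex K]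
    (hK : Module.finrank ℚ K = 2) {P Q : Ideal (𝓞 K)} (hP : P.IsMaximal) (hQ : Q.IsMaximal)
    (hne : P ≠ Q) (hN : Ideal.absNorm P = 2) (hPQ : Ideal.span {((2 : ℕ) : 𝓞 K)} = P * Q)
    (hpr : P.IsPrincipal) : ∃ x : K, x ^ 2 = -7 := by
  obtain ⟨α, hα⟩ := hpr
  change P = Ideal.span {α} at hα
  obtain ⟨t, n, h, hle, hn⟩ := exists_sq_eq_of_imaginaryQuadratic hK α
  rw [← hα, hN] at hn
  have hn2 : n = 2 := by
    have : 0 ≤ n := by nlinarith [sq_nonneg t]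
    omega
  subst hn2
  have htodd : ¬ 2 ∣ t := by
    rintro ⟨s, rfl⟩
    have h2 : α ^ 2 ∈ Q := by
      refine Ideal.mul_le_right (I := P) ?_
      rw [← hPQ, Ideal.mem_span_singleton]
      exact ⟨s * α - 1, by push_cast at h ⊢; linear_combination h⟩
    have hle : P ≤ Q := by
      rw [hα, Ideal.span_singleton_le_iff_mem]
      exact hQ.isPrime.mem_of_pow_mem _ h2
    exact hne (hP.eq_of_le hQ.ne_top hle)
  have ht : t ^ 2 = 1 := by
    have h1 : -3 < t := by nlinarith
    have h2 : t < 3 := by nlinarith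
    interval_cases t <;> simp_all
  refine ⟨algebraMap (𝓞 K) K (2 * α - t), ?_⟩
  have : (2 * α - t) ^ 2 = ((-7 : ℤ) : 𝓞 K) := by
    have ht' : (t : 𝓞 K) ^ 2 = 1 := by exact_mod_cast ht
    push_cast at h ⊢
    linear_combination 4 * h + ht'
  rw [← map_pow, this, map_intCast]
  norm_num

end NonprincipalIdeal

/-! ### Lower bounds for the ratio -/

section RatioBounds
open NumberField
variable {K : Type*} [Field K] [NumberField K]

theorem unitRatio_prime_pow_bounds (hK : Module.finrank ℚ K = 2) {c : ℝ} (hc : 1 ≤ c)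
    {E : Set ℕ} {p : ℕ} (hp : p.Prime) (h1 : c ≤ unitRatio K p) (h2 : c ^ 2 ≤ unitRatio K p * p)
    (h3 : p ∈ E ∨ c ^ 2 ≤ unitRatio K p) (k : ℕ) :
    c ≤ unitRatio K (p ^ (k + 1)) ∧
      (p ^ (k + 1) ∈ E ∨ c ^ 2 ≤ unitRatio K (p ^ (k + 1))) := by
  cases k with
  | zero => simpa using ⟨h1, h3⟩
  | succ k =>
    have hpk : (1 : ℝ) ≤ (p : ℝ) ^ k := one_le_pow₀ (by exact_mod_cast hp.one_lt.le)
    rw [unitRatio_prime_pow hK hp, pow_succ' (p : ℝ), ← mul_assoc]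
    have h4 : c ^ 2 ≤ unitRatio K p * p * (p : ℝ) ^ k := by nlinarith
    exact ⟨by nlinarith, Or.inr h4⟩

theorem le_unitRatio_of_mul_le (hK : Module.finrank ℚ K = 2) {p : ℕ} (hp : p.Prime) {c : ℝ}
    (h : c * p ≤ ((p : ℝ) - 1) ^ 2) : c ≤ unitRatio K p :=
  ((le_div_iff₀ (by exact_mod_cast hp.pos)).mpr h).trans (sub_one_sq_div_le_unitRatio hK hp)

theorem unitRatio_bounds_of_sq_eq_neg_one (hK : Module.finrank ℚ K = 2) {x : K} (hx : x ^ 2 = -1)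
    {f : ℕ} (hf : f ≠ 0) :
    f = 1 ∨ ((2 : ℝ) ≤ unitRatio K f ∧ (f ∈ ({2, 3, 5} : Set ℕ) ∨ (2 : ℝ) ^ 2 ≤ unitRatio K f)) := by
  obtain ⟨z, hz⟩ := exists_ringOfIntegers_sq_eq (x := x) (m := -1) (by simpa using hx)
  refine lowerBound_of_primePow (unitRatio_mul) one_le_two _ hf fun p k hp _ => ?_
  have h2 := le_unitRatio_two_of_sq_eq_neg_one hK (z := z) (by simpa using hz)
  have h3 := le_unitRatio_three_of_sq_eq hK (by norm_num) hz
  obtain ⟨h, hE⟩ : (2 : ℝ) ≤ unitRatio K p ∧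
      (p ∈ ({2, 3, 5} : Set ℕ) ∨ (2 : ℝ) ^ 2 ≤ unitRatio K p) := by
    obtain rfl | rfl | rfl | hge : p = 2 ∨ p = 3 ∨ p = 5 ∨ 7 ≤ p := by
      by_contra! hne
      have : p < 7 := hne.2.2.2
      interval_cases p <;> revert hp hne <;> norm_num
    · exact ⟨h2, Or.inl (by simp)⟩
    · exact ⟨by linarith, Or.inl (by simp)⟩
    · exact ⟨le_unitRatio_of_mul_le hK hp (by norm_num), Or.inl (by simp)⟩
    · have hge' : (7 : ℝ) ≤ p := by exact_mod_cast hge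
      have := le_unitRatio_of_mul_le hK hp (c := 2 ^ 2) (by nlinarith)
      exact ⟨by linarith, Or.inr this⟩
  have hp2 : (2 : ℝ) ≤ p := by exact_mod_cast hp.two_le
  exact unitRatio_prime_pow_bounds hK one_le_two hp h (by nlinarith) hE k

theorem unitRatio_bounds_of_isPrimitiveRoot_three (hK : Module.finrank ℚ K = 2) {ζ : K}
    (hζ : IsPrimitiveRoot ζ 3) {f : ℕ} (hf : f ≠ 0) :
    f = 1 ∨ ((3 : ℝ) ≤ unitRatio K f ∧
      (f ∈ ({2, 3, 5, 7} : Set ℕ) ∨ (3 : ℝ) ^ 2 ≤ unitRatio K f)) := by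
  obtain ⟨z, hz⟩ := exists_ringOfIntegers_sq_add_add_one hζ
  refine lowerBound_of_primePow (unitRatio_mul) (by norm_num) _ hf fun p k hp _ => ?_
  have h2 := le_unitRatio_two_of_sq_add_add_one hK hz
  have h3 := le_unitRatio_three_of_sq_add_add_one hK hz
  obtain ⟨h, hB, hE⟩ : (3 : ℝ) ≤ unitRatio K p ∧ (3 : ℝ) ^ 2 ≤ unitRatio K p * p ∧
      (p ∈ ({2, 3, 5, 7} : Set ℕ) ∨ (3 : ℝ) ^ 2 ≤ unitRatio K p) := by
    have hB (h : (3 : ℝ) ≤ unitRatio K p) (hp3 : 3 ≤ p) : (3 : ℝ) ^ 2 ≤ unitRatio K p * p := by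
      have : (3 : ℝ) ≤ p := by exact_mod_cast hp3
      nlinarith
    obtain rfl | rfl | rfl | rfl | hge : p = 2 ∨ p = 3 ∨ p = 5 ∨ p = 7 ∨ 11 ≤ p := by
      by_contra! hne
      have : p < 11 := hne.2.2.2.2
      interval_cases p <;> revert hp hne <;> norm_num
    · exact ⟨by linarith, by push_cast; linarith, Or.inl (by simp)⟩
    · exact ⟨h3, hB h3 le_rfl, Or.inl (by simp)⟩
    · have h := le_unitRatio_of_mul_le hK hp (c := 3) (by norm_num)
      exact ⟨h, hB h (by norm_num), Or.inl (by simp)⟩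
    · have h := le_unitRatio_of_mul_le hK hp (c := 3) (by norm_num)
      exact ⟨h, hB h (by norm_num), Or.inl (by simp)⟩
    · have hge' : (11 : ℝ) ≤ p := by exact_mod_cast hge
      have := le_unitRatio_of_mul_le hK hp (c := 3 ^ 2) (by nlinarith)
      exact ⟨by linarith, hB (by linarith) (by omega), Or.inr this⟩
  exact unitRatio_prime_pow_bounds hK (by norm_num) hp h hB hE k

theorem one_le_unitRatio_of_ne_two (hK : Module.finrank ℚ K = 2) {p : ℕ} (hp : p.Prime)
    (h2 : p ≠ 2) : 1 ≤ unitRatio K p := by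
  have : (3 : ℝ) ≤ p := by
    have := hp.two_le
    exact_mod_cast (by omega : 3 ≤ p)
  exact le_unitRatio_of_mul_le hK hp (by nlinarith)

theorem one_le_unitRatio_of_two (hK : Module.finrank ℚ K = 2) (h2 : 1 ≤ unitRatio K 2) {f : ℕ}
    (hf : f ≠ 0) : f = 1 ∨ 1 ≤ unitRatio K f := by
  have h := lowerBound_of_primePow (unitRatio_mul (K := K)) le_rfl Set.univ hf fun p k hp _ => ?_
  · exact h.imp_right And.left
  · have h1 : 1 ≤ unitRatio K p := by
      by_cases hp2 : p = 2
      · rw [hp2]; exact h2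
      · exact one_le_unitRatio_of_ne_two hK hp hp2
    refine unitRatio_prime_pow_bounds (E := Set.univ) hK le_rfl hp h1 ?_ (Or.inl trivial) k
    have : (1 : ℝ) ≤ p := by exact_mod_cast hp.one_lt.le
    nlinarith

theorem lowerBound_unitRatio_of_odd (hK : Module.finrank ℚ K = 2) {c : ℝ} (hc : 1 ≤ c)
    (h : ∀ p : ℕ, p.Prime → p ≠ 2 → c ≤ unitRatio K p) {m : ℕ} (hm : Odd m) :
    m = 1 ∨ c ≤ unitRatio K m := by
  have h := lowerBound_of_primePow (unitRatio_mul (K := K)) hc Set.univ hm.pos.ne'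
    fun p k hp hd => ⟨?_, Or.inl trivial⟩
  · exact h.imp_right And.left
  · have hp2 : p ≠ 2 := by
      rintro rfl
      exact (Nat.not_even_iff_odd.mpr hm) (even_iff_two_dvd.mpr
        ((dvd_pow_self 2 k.succ_ne_zero).trans hd))
    have h1 := h p hp hp2
    have hpk : (1 : ℝ) ≤ (p : ℝ) ^ k := one_le_pow₀ (by exact_mod_cast hp.one_lt.le)
    rw [unitRatio_prime_pow hK hp]
    nlinarith

/-- The powers of `2` contribute at least `1 / 2`, and less than `1` only for `2` itself. -/
theorem unitRatio_two_pow_bounds (hK : Module.finrank ℚ K = 2) (k : ℕ) :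
    1 / 2 ≤ unitRatio K (2 ^ (k + 1)) ∧ (k = 0 ∨ 1 ≤ unitRatio K (2 ^ (k + 1))) := by
  have h2 : 1 / 2 ≤ unitRatio K 2 := le_unitRatio_of_mul_le hK Nat.prime_two (by norm_num)
  rw [unitRatio_prime_pow hK Nat.prime_two]
  cases k with
  | zero => simpa using h2
  | succ k =>
    have : (1 : ℝ) ≤ 2 ^ k := one_le_pow₀ one_le_two
    have h4 : (1 : ℝ) ≤ unitRatio K 2 * (2 : ℕ) ^ (k + 1) := by
      rw [pow_succ]; push_cast; nlinarith
    exact ⟨le_trans (by norm_num) h4, Or.inr h4⟩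

/-- When `2` may split, a factor `1 / 2` is lost at `2`; if the odd primes contribute at least
`c ≤ 2`, it is lost in full only for `f = 2`. -/
theorem unitRatio_bounds_of_odd_primes (hK : Module.finrank ℚ K = 2) {c : ℝ} (hc : 1 ≤ c)
    (hc2 : c ≤ 2) (h : ∀ p : ℕ, p.Prime → p ≠ 2 → c ≤ unitRatio K p) {f : ℕ} (hf : f ≠ 0) :
    f = 1 ∨ (1 / 2 ≤ unitRatio K f ∧ (f = 2 ∨ c / 2 ≤ unitRatio K f)) := by
  obtain ⟨a, m, hm, rfl⟩ := Nat.exists_eq_two_pow_mul_odd hf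
  have hodd := lowerBound_unitRatio_of_odd hK hc h hm
  rcases a with - | k
  · rw [pow_zero, one_mul]
    exact hodd.imp_right fun h => ⟨by linarith, Or.inr (by linarith)⟩
  · right
    obtain ⟨h1, h2⟩ := unitRatio_two_pow_bounds hK k
    rcases hodd with rfl | hodd
    · rw [mul_one]
      refine ⟨h1, h2.imp (fun hk => by simp [hk]) fun h => by linarith⟩
    · have hco : Nat.Coprime (2 ^ (k + 1)) m := (Nat.coprime_two_left.mpr hm).pow_left _
      rw [unitRatio_mul _ _ hco]
      exact ⟨by nlinarith, Or.inr (by nlinarith)⟩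

theorem unitRatio_bounds_of_sq_eq_neg_seven (hK : Module.finrank ℚ K = 2) {x : K}
    (hx : x ^ 2 = -7) {f : ℕ} (hf : f ≠ 0) :
    f = 1 ∨ (1 / 2 ≤ unitRatio K f ∧ (f = 2 ∨ 1 ≤ unitRatio K f)) := by
  obtain ⟨z, hz⟩ := exists_ringOfIntegers_sq_eq (x := x) (m := -7) (by simpa using hx)
  have h := unitRatio_bounds_of_odd_primes hK one_le_two le_rfl (fun p hp hp2 => ?_) hf
  · simpa using h
  · by_cases hp3 : p = 3
    · have := le_unitRatio_three_of_sq_eq hK (by norm_num) hz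
      subst hp3; linarith
    · have h5 : (4 : ℝ) ≤ p := by
        have := hp.two_le
        exact_mod_cast (by omega : 4 ≤ p)
      exact le_unitRatio_of_mul_le hK hp (by nlinarith)

end RatioBounds

/-! ### Bounds for the degree of the ring class field -/

section RingClassField
open NumberField NumberField.Units
variable {K : Type*} [Field K] [NumberField K] [IsTotallyComplex K]

/-- The counting bound for the ring class field `L`, whose Galois group contains
`I_K(f)/P_{K,ℤ}(f)` through the Artin map. -/
theorem IsRingClassField.card_sq_mul_unitRatio_mul_le (hK : Module.finrank ℚ K = 2) {f : ℕ}
    (hf : 0 < f) {L : Type*} [Field L] [Algebra K L] (hL : IsRingClassField K L f) {c : ℕ}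
    (hc : torsionOrder K = 2 * c) {ι : Type*} [Finite ι] (J : ι → Ideal (𝓞 K))
    (hJ0 : ∀ i, J i ≠ ⊥) (hJ : ∀ i, IsPrimeToConductor f (J i))
    (hJi : ∀ i j, ∀ α β : 𝓞 K, α ≠ 0 → β ≠ 0 →
      Ideal.span {α} * J i = Ideal.span {β} * J j → i = j) :
    (Nat.card ι : ℝ) ^ 2 * (unitRatio K f * f) ≤ c ^ 2 * (Module.finrank K L : ℝ) ^ 2 := by
  have := hL.finite
  obtain ⟨φ, -, hφ⟩ := hL.ker_artinMap
  have h := two_mul_card_units_quotient_le hK hf φ hφ J hJ0 hJ hJi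
  have hG : Nat.card Gal(L/K) ≤ Module.finrank K L := by
    rw [Nat.card_eq_fintype_card]; exact AlgEquiv.card_le
  have hf' : (0 : ℝ) < f := by exact_mod_cast hf
  have ht : (0 : ℝ) < f.totient := by exact_mod_cast Nat.totient_pos.mpr hf
  have h1 : Nat.card ι * Nat.card (𝓞 K ⧸ Ideal.span {(f : 𝓞 K)})ˣ ≤
      c * Module.finrank K L * f.totient := by
    rw [hc] at h
    have := Nat.mul_le_mul_right (2 * c * f.totient) hG
    nlinarith
  have h2 : (Nat.card ι : ℝ) * Nat.card (𝓞 K ⧸ Ideal.span {(f : 𝓞 K)})ˣ ≤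
      c * Module.finrank K L * f.totient := by exact_mod_cast h1
  have h3 : unitRatio K f * f =
      (Nat.card (𝓞 K ⧸ Ideal.span {(f : 𝓞 K)})ˣ : ℝ) ^ 2 / (f.totient : ℝ) ^ 2 := by
    rw [unitRatio]; field_simp
  rw [h3, ← mul_div_assoc, div_le_iff₀ (by positivity), ← mul_pow, ← mul_pow, ← mul_pow]
  gcongr

theorem IsRingClassField.unitRatio_mul_le (hK : Module.finrank ℚ K = 2) {f : ℕ}
    (hf : 0 < f) {L : Type*} [Field L] [Algebra K L] (hL : IsRingClassField K L f) {c : ℕ}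
    (hc : torsionOrder K = 2 * c) :
    unitRatio K f * f ≤ c ^ 2 * (Module.finrank K L : ℝ) ^ 2 := by
  have := hL.card_sq_mul_unitRatio_mul_le hK hf hc (fun _ : Unit => ⊤) (fun _ => top_ne_bot)
    (fun _ => by rw [IsPrimeToConductor, ← Ideal.one_eq_top]; exact isCoprime_one_left)
    (fun _ _ _ _ _ _ _ => rfl)
  simpa using this

/-- A nonprincipal ideal doubles the number of classes that are counted. -/
theorem IsRingClassField.four_mul_unitRatio_mul_le (hK : Module.finrank ℚ K = 2) {f : ℕ}
    (hf : 0 < f) {L : Type*} [Field L] [Algebra K L] (hL : IsRingClassField K L f) {c : ℕ}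
    (hc : torsionOrder K = 2 * c) {P : Ideal (𝓞 K)} (hP : ¬ P.IsPrincipal) :
    4 * (unitRatio K f * f) ≤ c ^ 2 * (Module.finrank K L : ℝ) ^ 2 := by
  obtain ⟨A, hA0, hA, hApr⟩ := exists_not_isPrincipal_isPrimeToConductor hf hP
  have key {α β : 𝓞 K} (hβ : β ≠ 0) (h : Ideal.span {α} = Ideal.span {β} * A) : False := by
    have hβ0 : Ideal.span {β} ≠ ⊥ := by simpa [Ideal.span_singleton_eq_bot] using hβ
    obtain ⟨γ, rfl⟩ : β ∣ α := by
      rw [← Ideal.mem_span_singleton]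
      exact Ideal.mul_le_left (h ▸ Ideal.mem_span_singleton_self α)
    rw [← Ideal.span_singleton_mul_span_singleton] at h
    exact hApr ⟨γ, (mul_left_cancel₀ hβ0 h).symm⟩
  have := hL.card_sq_mul_unitRatio_mul_le hK hf hc (fun b : Bool => if b then A else ⊤)
    (fun b => by cases b; exacts [top_ne_bot, hA0])
    (fun b => by
      cases b
      · simp only [Bool.false_eq_true, if_false, IsPrimeToConductor, ← Ideal.one_eq_top]
        exact isCoprime_one_left
      · exact hA)
    (fun b b' α β hα hβ h => by
      cases b <;> cases b' <;> simp only [Bool.false_eq_true, if_false, if_true, Ideal.mul_top] at h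
      · rfl
      · exact (key hβ h).elim
      · exact (key hα h.symm).elim
      · rfl)
  rw [Nat.card_eq_fintype_card, Fintype.card_bool] at this
  norm_num at this
  exact this

/-- If `K` contains no square root of `-7` then either `2` does not split, or a prime above `2` is
not principal. -/
theorem IsRingClassField.le_finrank_sq (hK : Module.finrank ℚ K = 2) {f : ℕ}
    (hf : 0 < f) {L : Type*} [Field L] [Algebra K L] (hL : IsRingClassField K L f)
    (hw : torsionOrder K = 2) (h7 : ¬ ∃ x : K, x ^ 2 = -7) : f ≤ Module.finrank K L ^ 2 := by
  have := hL.finite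
  have hn : 1 ≤ Module.finrank K L ^ 2 := Nat.one_le_pow _ _ Module.finrank_pos
  have hf' : (0 : ℝ) < f := by exact_mod_cast hf
  suffices f = 1 ∨ (f : ℝ) ≤ (Module.finrank K L : ℝ) ^ 2 by
    rcases this with rfl | h
    · exact hn
    · exact_mod_cast h
  rcases le_unitRatio_or_split hK Nat.prime_two with h2 | ⟨P, Q, hP, hQ, hne, hN, -, hPQ⟩
  · have h := hL.unitRatio_mul_le hK hf (c := 1) hw
    refine (one_le_unitRatio_of_two hK (by norm_num at h2; linarith) hf.ne').imp_right fun h1 => ?_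
    norm_num at h
    nlinarith
  · have hpr : ¬ P.IsPrincipal := fun hpr =>
      h7 (exists_sq_eq_neg_seven_of_isPrincipal hK hP hQ hne hN hPQ hpr)
    have h := hL.four_mul_unitRatio_mul_le hK hf (c := 1) hw hpr
    refine (unitRatio_bounds_of_odd_primes hK le_rfl one_le_two
      (fun p hp hp2 => one_le_unitRatio_of_ne_two hK hp hp2) hf.ne').imp_right fun ⟨h1, _⟩ => ?_
    norm_num at h
    nlinarith

end RingClassField

theorem mainTheorem12 (K : Type*) [Field K] [NumberField K]
    [NumberField.IsTotallyComplex K] (hK : Module.finrank ℚ K = 2)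
    (f : ℕ) (hf : 0 < f)
    (Kf : Type*) [Field Kf] [Algebra K Kf] (hKf : IsRingClassField K Kf f) :
    ((∃ x : K, x ^ 2 = -7) → f ≤ max (Module.finrank K Kf ^ 2) 2) ∧
    ((∃ x : K, x ^ 2 = -1) → f ≤ max (Module.finrank K Kf ^ 2) 5) ∧
    ((∃ ζ : K, IsPrimitiveRoot ζ 3) → f ≤ max (Module.finrank K Kf ^ 2) 7) ∧
    ((¬ ∃ x : K, x ^ 2 = -7) → (¬ ∃ x : K, x ^ 2 = -1) → (¬ ∃ ζ : K, IsPrimitiveRoot ζ 3) →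
      f ≤ Module.finrank K Kf ^ 2) ∧
    f ≤ 3 * Module.finrank K Kf ^ 2 := by
  have := hKf.finite
  have hn : 1 ≤ Module.finrank K Kf ^ 2 := Nat.one_le_pow _ _ Module.finrank_pos
  have hf' : (0 : ℝ) < f := by exact_mod_cast hf
  have toNat {a : ℕ} (h : (f : ℝ) ≤ a * (Module.finrank K Kf : ℝ) ^ 2) :
      f ≤ a * Module.finrank K Kf ^ 2 := by exact_mod_cast h
  -- in each of the three exceptional fields both bounds come from the same estimate
  have h7 : (∃ x : K, x ^ 2 = -7) →
      f ≤ max (Module.finrank K Kf ^ 2) 2 ∧ f ≤ 3 * Module.finrank K Kf ^ 2 := by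
    rintro ⟨x, hx⟩
    have h := hKf.unitRatio_mul_le hK hf (c := 1) (torsionOrder_eq_two_of_sq_eq_neg_seven hK hx)
    norm_num at h
    rcases unitRatio_bounds_of_sq_eq_neg_seven hK hx hf.ne' with rfl | ⟨h1, h2⟩
    · omega
    · have h3 := toNat (a := 2) (by push_cast; nlinarith)
      refine ⟨?_, by omega⟩
      rcases h2 with h2 | h2
      · omega
      · have := toNat (a := 1) (by push_cast; nlinarith)
        omega
  have h1 : (∃ x : K, x ^ 2 = -1) →
      f ≤ max (Module.finrank K Kf ^ 2) 5 ∧ f ≤ 3 * Module.finrank K Kf ^ 2 := by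
    rintro ⟨x, hx⟩
    have h := hKf.unitRatio_mul_le hK hf (c := 2) (torsionOrder_eq_four hK hx)
    norm_num at h
    rcases unitRatio_bounds_of_sq_eq_neg_one hK hx hf.ne' with rfl | ⟨h1, h2⟩
    · omega
    · have h3 := toNat (a := 2) (by push_cast; nlinarith)
      refine ⟨?_, by omega⟩
      rcases h2 with h2 | h2
      · simp only [Set.mem_insert_iff, Set.mem_singleton_iff] at h2
        omega
      · have := toNat (a := 1) (by push_cast; nlinarith)
        omega
  have h3 : (∃ ζ : K, IsPrimitiveRoot ζ 3) →
      f ≤ max (Module.finrank K Kf ^ 2) 7 ∧ f ≤ 3 * Module.finrank K Kf ^ 2 := by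
    rintro ⟨ζ, hζ⟩
    have h := hKf.unitRatio_mul_le hK hf (c := 3) (torsionOrder_eq_six hK hζ)
    norm_num at h
    rcases unitRatio_bounds_of_isPrimitiveRoot_three hK hζ hf.ne' with rfl | ⟨h1, h2⟩
    · omega
    · have h3 := toNat (a := 3) (by push_cast; nlinarith)
      refine ⟨?_, h3⟩
      rcases h2 with h2 | h2
      · simp only [Set.mem_insert_iff, Set.mem_singleton_iff] at h2
        omega
      · have := toNat (a := 1) (by push_cast; nlinarith)
        omega
  have h0 : (¬ ∃ x : K, x ^ 2 = -7) → (¬ ∃ x : K, x ^ 2 = -1) →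
      (¬ ∃ ζ : K, IsPrimitiveRoot ζ 3) → f ≤ Module.finrank K Kf ^ 2 := by
    intro h7 h1 h3
    refine hKf.le_finrank_sq hK hf ?_ h7
    exact (torsionOrder_cases hK).resolve_right (not_or.mpr ⟨fun h => h1 h.2, fun h => h3 h.2⟩)
  refine ⟨fun h => (h7 h).1, fun h => (h1 h).1, fun h => (h3 h).1, h0, ?_⟩
  by_cases e7 : ∃ x : K, x ^ 2 = -7
  · exact (h7 e7).2
  by_cases e1 : ∃ x : K, x ^ 2 = -1
  · exact (h1 e1).2
  by_cases e3 : ∃ ζ : K, IsPrimitiveRoot ζ 3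
  · exact (h3 e3).2
  have := h0 e7 e1 e3
  omega
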